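/- Let $X^{(1)}, X^{(2)}, \dots$ be independent random points, each uniformly distributed in the unit square $(0,1)^2$. For $x, y \in \mathbb{R}^2$ write $x \prec y$ if $x_1 < y_1$ and $x_2 < y_2$. The observation $X^{(n)}$ sets a (Pareto) record if there is no $1 \le i < n$ with $X^{(i)} \prec X^{(n)}$. For $1 \le j \le n$, the observation $X^{(j)}$ is a current record at time $n$ if there is no $1 \le i \le n$ with $X^{(i)} \prec X^{(j)}$. If $X^{(n)}$ sets a record, it kills exactly $k$ records if there are exactly $k$ indices $1 \le j < n$ such that $X^{(j)}$ is a current record at time $n-1$ but not at time $n$. Let $R_n$ be the number of records among $X^{(1)}, \dots, X^{(n)}$, let $R_{n,k}$ be the number of those records that kill exactly $k$ records, and put $\rho_n = \mathbb{E} R_n$ and $\rho_{n,k} = \mathbb{E} R_{n,k}$. Let $H_n = \sum_{i=1}^n i^{-1}$, $H_n^{(2)} = \sum_{i=1}^n i^{-2}$ and $c_n^{(2)} = \sum_{i=1}^n i^{-1} H_i$. Then, for every $n \ge 1$, $$\rho_n = c_n^{(2)},$$ and, for every $n \ge 1$ and every integer $k \ge 0$, $$\left| \rho_{n,k} - \left(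 2^{-(k+1)} c_n^{(2)} - (k-1) 2^{-(k+2)} H_n \right) \right| \le \tfrac12 H_n^{(2)} < 1.$$ Consequently $\rho_{n,k}/\rho_n \to 2^{-(k+1)}$ as $n \to \infty$, uniformly in $k \ge 0$. -/

import Mathlib

open MeasureTheory ProbabilityTheory Filter

namespace ParetoRecords

/-- Strict coordinatewise dominance `x ≺ y` in the plane. (This is not the order `<` of `ℝ × ℝ`.) -/
def Prec (x y : ℝ × ℝ) : Prop := x.1 < y.1 ∧ x.2 < y.2

/-- For a sequence of observations `x 1, x 2, …` (the value `x 0` is never used):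
the `n`-th observation sets a (Pareto) record. -/
def SetsRecord (x : ℕ → ℝ × ℝ) (n : ℕ) : Prop :=
  ∀ i, 1 ≤ i → i < n → ¬ Prec (x i) (x n)

/-- The `j`-th observation is a current (remaining) record at time `n`, where `1 ≤ j ≤ n`. -/
def IsCurrentRecord (x : ℕ → ℝ × ℝ) (j n : ℕ) : Prop :=
  1 ≤ j ∧ j ≤ n ∧ ∀ i, 1 ≤ i → i ≤ n → ¬ Prec (x i) (x j)

open Classical in
/-- The times `1 ≤ j < n` such that the `j`-th observation is a current record at time `n - 1`
but no longer a current record at time `n`. -/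
noncomputable def killedTimes (x : ℕ → ℝ × ℝ) (n : ℕ) : Finset ℕ :=
  (Finset.Ico 1 n).filter fun j => IsCurrentRecord x j (n - 1) ∧ ¬ IsCurrentRecord x j n

/-- The `n`-th observation sets a record and kills exactly `k` records. -/
def KillsExactly (x : ℕ → ℝ × ℝ) (n k : ℕ) : Prop :=
  SetsRecord x n ∧ (killedTimes x n).card = k

open Classical in
/-- `R_n`: the number of records among the observations `1, …, n`. -/
noncomputable def numRecords (x : ℕ → ℝ × ℝ) (n : ℕ) : ℕ :=
  ((Finset.Icc 1 n).filter fun i => SetsRecord x i).card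

open Classical in
/-- `R_{n,k}`: the number of records among the observations `1, …, n` that kill exactly `k`
records. -/
noncomputable def numRecordsKilling (x : ℕ → ℝ × ℝ) (n k : ℕ) : ℕ :=
  ((Finset.Icc 1 n).filter fun i => KillsExactly x i k).card

/-- The second-order harmonic number `H_n^{(2)}`. -/
noncomputable def harmonic2 (n : ℕ) : ℝ := ∑ i ∈ Finset.Icc 1 n, 1 / (i : ℝ) ^ 2

/-- The second-order Roman harmonic number `c_n^{(2)} = ∑_{i=1}^n H_i / i`. -/
noncomputable def romanHarmonic2 (n : ℕ) : ℝ := ∑ i ∈ Finset.Icc 1 n, (harmonic i : ℝ) / (i : ℝ)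

/-- The approximation `2^{-(k+1)} c_n^{(2)} - (k - 1) 2^{-(k+2)} H_n`. -/
noncomputable def rhoHat (n k : ℕ) : ℝ :=
  (1 / 2 : ℝ) ^ (k + 1) * romanHarmonic2 n
    - ((k : ℝ) - 1) * (1 / 2 : ℝ) ^ (k + 2) * (harmonic n : ℝ)

/-- `ρ_n`: the expected number of records by time `n`. -/
noncomputable def rho {Ω : Type*} [MeasurableSpace Ω] (P : Measure Ω)
    (X : ℕ → Ω → ℝ × ℝ) (n : ℕ) : ℝ :=
  ∫ ω, (numRecords (fun i => X i ω) n : ℝ) ∂P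

/-- `ρ_{n,k}`: the expected number of records by time `n` that kill exactly `k` records. -/
noncomputable def rhoKilling {Ω : Type*} [MeasurableSpace Ω] (P : Measure Ω)
    (X : ℕ → Ω → ℝ × ℝ) (n k : ℕ) : ℝ :=
  ∫ ω, (numRecordsKilling (fun i => X i ω) n k : ℝ) ∂P

end ParetoRecords

/-! If the newest of `n` points is a record, it kills exactly the points that it dominates and no
other point does. By exchangeability, its expected weight is `1/n` times the expected total weight
of all minimal points (`integral_recordWeight`). Permuting second coordinates preserves the law, so
this total can be averaged over all assignments of the heights to the points; that average is the
same for all configurations with distinct coordinates (`sum_totalWeight_permuteSnd`).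

To compute it, build the configuration from left to right. The added point is rightmost, so it
dominates nothing. If it is lowest, it is a new minimal point exposing nothing; if second lowest, it
is exposed by the lowest point alone; otherwise at least two points dominate it and no exposed set
changes. The `m`-th point is of one of the first two kinds with probability `2/m`, each kind being
equally likely. So minimal points correspond to the runs of a word of fair letters: a run starts at
each "lowest" (the first point included), and its length is the number of "second lowest" letters
that follow.

Given `c` letters after the first, the expected number of runs of length `k` is affine in `c` up to
`2^(-c)/4` (`runCountMean_sub_le`). Here `c` has mean `2 (H_n - 1)` and `2^(-c)` has mean `∏ (1 -
1/m) = 1/n`, so time `n` contributes an error of at most `1/(4 n^2)`; summing gives the bound. The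
uniform limit follows from `H_n^2 ≤ 2 c_n^(2)`. -/

namespace ParetoRecords

/-! ### Weights of minimal points -/

open Classical in
/-- For a domination relation `d`, the points that are dominated by `j` and by no other point. -/
noncomputable def exposed {ι : Type*} [Fintype ι] (d : ι → ι → Prop) (j : ι) : Finset ι :=
  Finset.univ.filter fun m => d j m ∧ ∀ i, i ≠ j → ¬ d i m

open Classical in
/-- The weight `F c` of a minimal point `j` that exposes `c` points; non-minimal points weigh `0`. -/
noncomputable def recordWeight {ι : Type*} [Fintype ι] (F : ℕ → ℝ) (d : ι → ι → Prop) (j : ι) : ℝ :=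
  if ∀ i, ¬ d i j then F (exposed d j).card else 0

/-- The total weight of the minimal points. -/
noncomputable def totalWeight {ι : Type*} [Fintype ι] (F : ℕ → ℝ) (d : ι → ι → Prop) : ℝ :=
  ∑ j, recordWeight F d j

/-- Domination among points with heights `y` whose first coordinates decrease with the index. -/
def seqDom {n : ℕ} (y : Fin n → ℝ) (i j : Fin n) : Prop := j < i ∧ y i < y j

open Classical in
/-- The weight of the points of smallest height. -/
noncomputable def lowestWeight {n : ℕ} (G : ℕ → ℝ) (y : Fin n → ℝ) : ℝ :=
  ∑ j, if ∀ i, i ≠ j → y j < y i then G (exposed (seqDom y) j).card else 0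

lemma recordWeight_equiv {ι κ : Type*} [Fintype ι] [Fintype κ] (F : ℕ → ℝ) (d : ι → ι → Prop)
    (g : κ ≃ ι) (j : κ) :
    recordWeight F (fun a b => d (g a) (g b)) j = recordWeight F d (g j) := by
  classical
  have hc : (exposed (fun a b => d (g a) (g b)) j).card = (exposed d (g j)).card := by
    refine Finset.card_equiv g fun m => ?_
    simp only [exposed, Finset.mem_filter, Finset.mem_univ, true_and]
    refine and_congr_right fun _ => ?_
    rw [← g.forall_congr_right]
    simp
  have hm : (∀ i, ¬ d (g i) (g j)) ↔ ∀ i, ¬ d i (g j) :=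
    g.forall_congr_right (q := fun i => ¬ d i (g j))
  simp only [recordWeight, hc, hm]

lemma totalWeight_equiv {ι κ : Type*} [Fintype ι] [Fintype κ] (F : ℕ → ℝ) (d : ι → ι → Prop)
    (g : κ ≃ ι) :
    totalWeight F (fun a b => d (g a) (g b)) = totalWeight F d := by
  simp only [totalWeight, recordWeight_equiv F d g]
  exact g.sum_comp fun j => recordWeight F d j

/-! ### Adding a rightmost point -/

section Cons

variable {n : ℕ} (s : ℝ) (z : Fin n → ℝ)

lemma seqDom_cons_zero_left (j : Fin (n + 1)) :
    ¬ seqDom (Fin.cons s z : Fin (n + 1) → ℝ) 0 j := by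
  simp [seqDom]

lemma seqDom_cons_succ_zero (i : Fin n) :
    seqDom (Fin.cons s z : Fin (n + 1) → ℝ) i.succ 0 ↔ z i < s := by
  simp [seqDom]

lemma seqDom_cons_succ_succ (i j : Fin n) :
    seqDom (Fin.cons s z : Fin (n + 1) → ℝ) i.succ j.succ ↔ seqDom z i j := by
  simp [seqDom]

lemma exposed_cons_zero : exposed (seqDom (Fin.cons s z : Fin (n + 1) → ℝ)) 0 = ∅ := by
  simp [exposed, seqDom_cons_zero_left]

-- Every old point lies to the left of the new one, so domination of the new point is decided by
-- heights alone.
open Classical in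
lemma card_exposed_cons_succ (j : Fin n) :
    (exposed (seqDom (Fin.cons s z : Fin (n + 1) → ℝ)) j.succ).card =
      (exposed (seqDom z) j).card + if z j < s ∧ ∀ i, i ≠ j → ¬ z i < s then 1 else 0 := by
  simp only [exposed, Finset.card_filter]
  rw [Fin.sum_univ_succ, add_comm]
  simp only [Fin.forall_fin_succ, seqDom_cons_zero_left, seqDom_cons_succ_zero,
    seqDom_cons_succ_succ, ne_eq, Fin.succ_inj, not_false_eq_true, implies_true, true_and]
  congr!

lemma totalWeight_cons (F : ℕ → ℝ) :
    totalWeight F (seqDom (Fin.cons s z : Fin (n + 1) → ℝ)) =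
      recordWeight F (seqDom (Fin.cons s z : Fin (n + 1) → ℝ)) 0 +
      ∑ j : Fin n, recordWeight F (seqDom (Fin.cons s z : Fin (n + 1) → ℝ)) j.succ :=
  Fin.sum_univ_succ _

open Classical in
lemma recordWeight_cons_zero (F : ℕ → ℝ) :
    recordWeight F (seqDom (Fin.cons s z : Fin (n + 1) → ℝ)) 0 =
      if ∀ i, ¬ z i < s then F 0 else 0 := by
  simp only [recordWeight, exposed_cons_zero, Finset.card_empty, Fin.forall_fin_succ,
    seqDom_cons_zero_left, seqDom_cons_succ_zero, not_false_eq_true, true_and]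

open Classical in
lemma recordWeight_cons_succ (F : ℕ → ℝ) (j : Fin n) :
    recordWeight F (seqDom (Fin.cons s z : Fin (n + 1) → ℝ)) j.succ =
      if ∀ i, ¬ seqDom z i j then F ((exposed (seqDom z) j).card +
        if z j < s ∧ ∀ i, i ≠ j → ¬ z i < s then 1 else 0) else 0 := by
  simp only [recordWeight, card_exposed_cons_succ, Fin.forall_fin_succ, seqDom_cons_zero_left,
    seqDom_cons_succ_succ, not_false_eq_true, true_and]

open Classical in
lemma lowestWeight_cons (G : ℕ → ℝ) :
    lowestWeight G (Fin.cons s z : Fin (n + 1) → ℝ) =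
      (if ∀ i, s < z i then G 0 else 0) +
      ∑ j, if z j < s ∧ ∀ i, i ≠ j → z j < z i then G ((exposed (seqDom z) j).card +
        if z j < s ∧ ∀ i, i ≠ j → ¬ z i < s then 1 else 0) else 0 := by
  simp only [lowestWeight, Fin.sum_univ_succ, exposed_cons_zero, card_exposed_cons_succ,
    Fin.forall_fin_succ, Fin.cons_zero, Fin.cons_succ, ne_eq, Fin.succ_inj, Fin.succ_ne_zero,
    not_true_eq_false, not_false_eq_true, false_imp_iff, true_imp_iff, true_and, Finset.card_empty,
    (Fin.succ_ne_zero _).symm]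

variable {s z}

lemma totalWeight_cons_of_lowest (hr : ∀ i, s < z i) (F : ℕ → ℝ) :
    totalWeight F (seqDom (Fin.cons s z : Fin (n + 1) → ℝ)) = totalWeight F (seqDom z) + F 0 := by
  classical
  have h : ∀ i, ¬ z i < s := fun i => (hr i).not_gt
  rw [totalWeight_cons, recordWeight_cons_zero, add_comm, if_pos h, totalWeight]
  refine congrArg (· + F 0) (Finset.sum_congr rfl fun j _ => ?_)
  rw [recordWeight_cons_succ, recordWeight, if_neg (c := z j < s ∧ _) fun hj => h j hj.1, add_zero]
  congr!

lemma lowestWeight_cons_of_lowest (hr : ∀ i, s < z i) (G : ℕ → ℝ) :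
    lowestWeight G (Fin.cons s z : Fin (n + 1) → ℝ) = G 0 := by
  classical
  have h : ∀ i, ¬ z i < s := fun i => (hr i).not_gt
  simp [lowestWeight_cons, h, hr]

/-- Both conditions single out `k`, the lowest old point. -/
lemma lt_and_forall_not_lt_iff {k : Fin n} (hk : z k < s) (hk' : ∀ i, i ≠ k → ¬ z i < s)
    (j : Fin n) : (z j < s ∧ ∀ i, i ≠ j → ¬ z i < s) ↔ ∀ i, i ≠ j → z j < z i := by
  constructor
  · rintro ⟨h1, h2⟩ i hi
    exact h1.trans_le (not_lt.1 (h2 i hi))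
  · intro h
    have hjk : j = k := by
      by_contra hne
      exact hk' j hne ((h k (Ne.symm hne)).trans hk)
    subst hjk
    exact ⟨hk, hk'⟩

/-- Only the lowest old point, which is minimal, exposes the new one; its weight changes from `F c`
to `F (c + 1)`. -/
lemma totalWeight_cons_of_second {k : Fin n} (hk : z k < s) (hk' : ∀ i, i ≠ k → ¬ z i < s)
    (F : ℕ → ℝ) :
    totalWeight F (seqDom (Fin.cons s z : Fin (n + 1) → ℝ)) =
      totalWeight F (seqDom z) + lowestWeight (fun c => F (c + 1)) z - lowestWeight F z := by
  classical
  have h0 : ¬ ∀ i, ¬ z i < s := fun h => h k hk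
  rw [totalWeight_cons, recordWeight_cons_zero, if_neg h0, zero_add, totalWeight, lowestWeight,
    lowestWeight, ← Finset.sum_add_distrib, ← Finset.sum_sub_distrib]
  refine Finset.sum_congr rfl fun j _ => ?_
  rw [recordWeight_cons_succ, recordWeight]
  simp only [lt_and_forall_not_lt_iff hk hk']
  by_cases hj : ∀ i, i ≠ j → z j < z i
  · have hrec : ∀ i, ¬ seqDom z i j := fun i hi => (hi.2).not_gt (hj i hi.1.ne')
    simp only [if_pos hj, if_pos hrec]
    ring
  · simp only [if_neg hj, add_zero, sub_zero]
    congr!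

lemma lowestWeight_cons_of_second {k : Fin n} (hk : z k < s) (hk' : ∀ i, i ≠ k → ¬ z i < s)
    (G : ℕ → ℝ) :
    lowestWeight G (Fin.cons s z : Fin (n + 1) → ℝ) = lowestWeight (fun c => G (c + 1)) z := by
  classical
  have h0 : ¬ ∀ i, s < z i := fun h => (h k).not_gt hk
  rw [lowestWeight_cons, if_neg h0, zero_add, lowestWeight]
  refine Finset.sum_congr rfl fun j _ => ?_
  have := lt_and_forall_not_lt_iff hk hk' j
  simp only [this]
  by_cases hj : ∀ i, i ≠ j → z j < z i
  · simp only [if_pos hj, (this.2 hj).1, true_and]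
  · rw [if_neg fun h => hj h.2, if_neg hj]

/-- Two points dominate the new one, so it is neither minimal nor exposed. -/
lemma totalWeight_cons_of_high {k l : Fin n} (hkl : k ≠ l) (hk : z k < s) (hl : z l < s)
    (F : ℕ → ℝ) :
    totalWeight F (seqDom (Fin.cons s z : Fin (n + 1) → ℝ)) = totalWeight F (seqDom z) := by
  classical
  have h0 : ¬ ∀ i, ¬ z i < s := fun h => h k hk
  have h1 : ∀ j, ¬ (z j < s ∧ ∀ i, i ≠ j → ¬ z i < s) := by
    rintro j ⟨-, h⟩
    by_cases hj : k = j
    · exact h l (hj ▸ hkl.symm) hl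
    · exact h k hj hk
  rw [totalWeight_cons, recordWeight_cons_zero, if_neg h0, zero_add, totalWeight]
  refine Finset.sum_congr rfl fun j _ => ?_
  rw [recordWeight_cons_succ, recordWeight, if_neg (h1 j), add_zero]
  congr!

lemma lowestWeight_cons_of_high {k l : Fin n} (hkl : k ≠ l) (hk : z k < s) (hl : z l < s)
    (G : ℕ → ℝ) :
    lowestWeight G (Fin.cons s z : Fin (n + 1) → ℝ) = lowestWeight G z := by
  classical
  have h0 : ¬ ∀ i, s < z i := fun h => (h k).not_gt hk
  have h1 : ∀ j, ¬ (z j < s ∧ ∀ i, i ≠ j → ¬ z i < s) := by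
    rintro j ⟨-, h⟩
    by_cases hj : k = j
    · exact h l (hj ▸ hkl.symm) hl
    · exact h k hj hk
  have h2 : ∀ j, (∀ i, i ≠ j → z j < z i) → z j < s := by
    intro j h
    by_cases hj : k = j
    · exact hj ▸ hk
    · exact (h k hj).trans hk
  rw [lowestWeight_cons, if_neg h0, zero_add, lowestWeight]
  refine Finset.sum_congr rfl fun j _ => ?_
  rw [if_neg (h1 j), add_zero]
  refine if_congr ⟨fun h => h.2, fun h => ⟨h2 j h, h⟩⟩ rfl rfl

end Cons

/-! ### Averages over orderings of the heights -/

/-- The mean of `lowestWeight G` over the orderings of `n + 1` distinct heights. -/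
noncomputable def lowestMean : ℕ → (ℕ → ℝ) → ℝ
  | 0, G => G 0
  | n + 1, G => (G 0 + lowestMean n (fun c => G (c + 1)) + n * lowestMean n G) / (n + 2)

/-- The mean of `totalWeight F` over the orderings of `n + 1` distinct heights. -/
noncomputable def totalMean : ℕ → (ℕ → ℝ) → ℝ
  | 0, F => F 0
  | n + 1, F =>
    totalMean n F + (F 0 + lowestMean n (fun c => F (c + 1)) - lowestMean n F) / (n + 2)

/-- The number of heights below that of `p`. -/
noncomputable def heightRank {n : ℕ} (y : Fin n → ℝ) (p : Fin n) : ℕ :=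
  (Finset.univ.filter fun q => y q < y p).card

lemma heightRank_lt {n : ℕ} (y : Fin n → ℝ) (p : Fin n) : heightRank y p < n := by
  have : (Finset.univ.filter fun q => y q < y p) ⊂ Finset.univ :=
    Finset.filter_ssubset.2 ⟨p, Finset.mem_univ _, lt_irrefl _⟩
  simpa [heightRank] using Finset.card_lt_card this

/-- For distinct heights the rank is injective into `Fin n`, hence a bijection. -/
lemma sum_heightRank {n : ℕ} {y : Fin n → ℝ} (hy : Function.Injective y) (f : ℕ → ℝ) :
    ∑ p, f (heightRank y p) = ∑ k : Fin n, f k := by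
  have hmono : ∀ p q, y p < y q → heightRank y p < heightRank y q := by
    intro p q h
    refine Finset.card_lt_card (Finset.ssubset_iff_of_subset ?_ |>.2 ⟨p, ?_, ?_⟩)
    · intro a ha
      simp only [Finset.mem_filter, Finset.mem_univ, true_and] at ha ⊢
      exact ha.trans h
    · simpa using h
    · simp
  let r : Fin n → Fin n := fun p => ⟨heightRank y p, heightRank_lt y p⟩
  have hr : Function.Injective r := by
    intro p q h
    have h' : heightRank y p = heightRank y q := congrArg Fin.val h
    by_contra hne
    rcases lt_or_gt_of_ne (hy.ne hne) with h1 | h1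
    · exact (hmono _ _ h1).ne h'
    · exact (hmono _ _ h1).ne' h'
  exact (Equiv.ofBijective r (Finite.injective_iff_bijective.1 hr)).sum_comp fun k : Fin n => f k

/-- The heights other than that of `p`. -/
def otherHeights {n : ℕ} (y : Fin (n + 1) → ℝ) (p : Fin (n + 1)) (i : Fin n) : ℝ :=
  y (Equiv.swap 0 p i.succ)

lemma otherHeights_injective {n : ℕ} {y : Fin (n + 1) → ℝ} (hy : Function.Injective y)
    (p : Fin (n + 1)) : Function.Injective (otherHeights y p) :=
  hy.comp ((Equiv.injective _).comp (Fin.succ_injective _))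

lemma otherHeights_ne {n : ℕ} {y : Fin (n + 1) → ℝ} (hy : Function.Injective y)
    (p : Fin (n + 1)) (i : Fin n) : otherHeights y p i ≠ y p := by
  intro h
  have := hy h
  rw [Equiv.swap_apply_eq_iff, Equiv.swap_apply_right] at this
  exact Fin.succ_ne_zero _ this

lemma card_otherHeights_lt {n : ℕ} (y : Fin (n + 1) → ℝ) (p : Fin (n + 1))
    (e : Equiv.Perm (Fin n)) :
    (Finset.univ.filter fun i => otherHeights y p (e i) < y p).card = heightRank y p := by
  rw [heightRank, Finset.card_filter, Finset.card_filter,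
    ← Equiv.sum_comp (Equiv.swap 0 p), Fin.sum_univ_succ]
  simp only [Equiv.swap_apply_left, lt_irrefl, if_false, zero_add]
  exact Equiv.sum_comp e fun i => if otherHeights y p i < y p then 1 else 0

lemma sum_perm_succ {n : ℕ} (y : Fin (n + 1) → ℝ) (Φ : (Fin (n + 1) → ℝ) → ℝ) :
    ∑ π : Equiv.Perm (Fin (n + 1)), Φ (y ∘ π) =
      ∑ p, ∑ e : Equiv.Perm (Fin n), Φ (Fin.cons (y p) (otherHeights y p ∘ e)) := by
  rw [← Equiv.Perm.decomposeFin.symm.sum_comp, Fintype.sum_prod_type]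
  refine Finset.sum_congr rfl fun p _ => Finset.sum_congr rfl fun e _ => congrArg Φ ?_
  funext i
  refine Fin.cases ?_ (fun i => ?_) i
  · simp
  · simp [otherHeights]

/-- Each rank of the rightmost height occurs once: rank 0 gives `a₀`, rank 1 gives `a₁`, and the `n`
remaining ranks give `a₂` each. -/
lemma sum_perm_succ_of_heightRank {n : ℕ} {y : Fin (n + 2) → ℝ} (hy : Function.Injective y)
    (Φ : (Fin (n + 2) → ℝ) → ℝ) (a₀ a₁ a₂ : ℝ)
    (h₀ : ∀ (s : ℝ) (z : Fin (n + 1) → ℝ), Function.Injective z → (∀ i, s < z i) →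
      ∑ e : Equiv.Perm (Fin (n + 1)), Φ (Fin.cons s (z ∘ e)) = a₀)
    (h₁ : ∀ (s : ℝ) (z : Fin (n + 1) → ℝ) (k : Fin (n + 1)), Function.Injective z → z k < s →
      (∀ i, i ≠ k → ¬ z i < s) → ∑ e : Equiv.Perm (Fin (n + 1)), Φ (Fin.cons s (z ∘ e)) = a₁)
    (h₂ : ∀ (s : ℝ) (z : Fin (n + 1) → ℝ) (k l : Fin (n + 1)), Function.Injective z → k ≠ l →
      z k < s → z l < s → ∑ e : Equiv.Perm (Fin (n + 1)), Φ (Fin.cons s (z ∘ e)) = a₂) :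
    ∑ π : Equiv.Perm (Fin (n + 2)), Φ (y ∘ π) = a₀ + a₁ + n * a₂ := by
  rw [sum_perm_succ]
  let f : ℕ → ℝ := fun k => match k with
    | 0 => a₀
    | 1 => a₁
    | _ + 2 => a₂
  have hp : ∀ p, ∑ e : Equiv.Perm (Fin (n + 1)), Φ (Fin.cons (y p) (otherHeights y p ∘ e)) =
      f (heightRank y p) := by
    intro p
    have hinj := otherHeights_injective hy p
    have hne := otherHeights_ne hy p
    have hcard : (Finset.univ.filter fun i => otherHeights y p i < y p).card = heightRank y p :=
      card_otherHeights_lt y p 1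
    rcases hr : heightRank y p with _ | _ | r
    · rw [hr, Finset.card_eq_zero, Finset.filter_eq_empty_iff] at hcard
      refine h₀ _ _ hinj fun i => ?_
      exact lt_of_le_of_ne (not_lt.1 (hcard (Finset.mem_univ i))) (hne i).symm
    · rw [hr, zero_add, Finset.card_eq_one] at hcard
      obtain ⟨k, hk⟩ := hcard
      simp only [Finset.ext_iff, Finset.mem_filter, Finset.mem_univ, true_and,
        Finset.mem_singleton] at hk
      exact h₁ _ _ k hinj ((hk k).2 rfl) fun i hi h => hi ((hk i).1 h)
    · have h1 : 1 < (Finset.univ.filter fun i => otherHeights y p i < y p).card := by omega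
      obtain ⟨k, hk, l, hl, hkl⟩ := Finset.one_lt_card.1 h1
      exact h₂ _ _ k l hinj hkl (by simpa using hk) (by simpa using hl)
  rw [Finset.sum_congr rfl fun p _ => hp p, sum_heightRank hy, Fin.sum_univ_succ,
    Fin.sum_univ_succ]
  simp [f, add_assoc]

lemma sum_perm_lowestWeight (n : ℕ) : ∀ (y : Fin (n + 1) → ℝ), Function.Injective y →
    ∀ G : ℕ → ℝ, ∑ π : Equiv.Perm (Fin (n + 1)), lowestWeight G (y ∘ π) =
      (n + 1).factorial * lowestMean n G := by
  induction n with
  | zero =>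
    intro y _ G
    simp [lowestWeight, lowestMean, exposed, seqDom]
  | succ n ih =>
    intro y hy G
    rw [sum_perm_succ_of_heightRank hy _ ((n + 1).factorial * G 0)
      ((n + 1).factorial * lowestMean n fun c => G (c + 1)) ((n + 1).factorial * lowestMean n G),
      Nat.factorial_succ (n + 1), Nat.cast_mul, lowestMean]
    · generalize ((n + 1).factorial : ℝ) = f
      push_cast
      field_simp
      ring
    · intro s z _ hs
      rw [Finset.sum_congr rfl fun e _ => lowestWeight_cons_of_lowest (fun i => hs (e i)) G]
      simp [Fintype.card_perm]
    · intro s z k hz hk hk'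
      rw [← ih z hz]
      refine Finset.sum_congr rfl fun e _ => lowestWeight_cons_of_second (k := e.symm k) ?_ ?_ G
      · simpa using hk
      · exact fun i hi => hk' _ fun h => hi (by simp [← h])
    · intro s z k l hz hkl hk hl
      rw [← ih z hz]
      refine Finset.sum_congr rfl fun e _ =>
        lowestWeight_cons_of_high (k := e.symm k) (l := e.symm l) ?_ ?_ ?_ G
      · simpa using hkl
      · simpa using hk
      · simpa using hl

lemma sum_perm_totalWeight (n : ℕ) : ∀ (y : Fin (n + 1) → ℝ), Function.Injective y →
    ∀ F : ℕ → ℝ, ∑ π : Equiv.Perm (Fin (n + 1)), totalWeight F (seqDom (y ∘ π)) =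
      (n + 1).factorial * totalMean n F := by
  induction n with
  | zero =>
    intro y _ F
    simp [totalWeight, recordWeight, totalMean, exposed, seqDom]
  | succ n ih =>
    intro y hy F
    rw [sum_perm_succ_of_heightRank hy (fun y => totalWeight F (seqDom y))
      ((n + 1).factorial * totalMean n F + (n + 1).factorial * F 0)
      ((n + 1).factorial * totalMean n F +
        (n + 1).factorial * lowestMean n (fun c => F (c + 1)) -
          (n + 1).factorial * lowestMean n F)
      ((n + 1).factorial * totalMean n F),
      Nat.factorial_succ (n + 1), Nat.cast_mul, totalMean]
    · generalize ((n + 1).factorial : ℝ) = f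
      push_cast
      field_simp
      ring
    · intro s z hz hs
      rw [Finset.sum_congr rfl fun e _ => totalWeight_cons_of_lowest (fun i => hs (e i)) F,
        Finset.sum_add_distrib, ← ih z hz]
      simp [Fintype.card_perm, Function.comp_def]
    · intro s z k hz hk hk'
      rw [← ih z hz, ← sum_perm_lowestWeight n z hz, ← sum_perm_lowestWeight n z hz,
        ← Finset.sum_add_distrib, ← Finset.sum_sub_distrib]
      refine Finset.sum_congr rfl fun e _ => totalWeight_cons_of_second (k := e.symm k) ?_ ?_ F
      · simpa using hk
      · exact fun i hi => hk' _ fun h => hi (by simp [← h])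
    · intro s z k l hz hkl hk hl
      rw [← ih z hz]
      refine Finset.sum_congr rfl fun e _ =>
        totalWeight_cons_of_high (k := e.symm k) (l := e.symm l) ?_ ?_ ?_ F
      · simpa using hkl
      · simpa using hk
      · simpa using hl

/-! ### Runs in a word of fair letters -/

/-- Expectation of `g` at the number of indices `m ∈ {2, …, n + 1}` selected when each `m` is
selected independently with probability `2 / m`. -/
noncomputable def eventMean : ℕ → (ℕ → ℝ) → ℝ
  | 0, g => g 0
  | n + 1, g => (2 * eventMean n (fun c => g (c + 1)) + n * eventMean n g) / (n + 2)

lemma eventMean_add (n : ℕ) : ∀ g h : ℕ → ℝ,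
    eventMean n (fun c => g c + h c) = eventMean n g + eventMean n h := by
  induction n with
  | zero => intro g h; rfl
  | succ n ih => intro g h; simp only [eventMean, ih]; ring

lemma eventMean_smul (n : ℕ) : ∀ (a : ℝ) (g : ℕ → ℝ),
    eventMean n (fun c => a * g c) = a * eventMean n g := by
  induction n with
  | zero => intro a g; rfl
  | succ n ih => intro a g; simp only [eventMean, ih]; ring

lemma eventMean_const (n : ℕ) (a : ℝ) : eventMean n (fun _ => a) = a := by
  induction n with
  | zero => rfl
  | succ n ih => simp only [eventMean, ih]; field_simp; ring

lemma eventMean_mono (n : ℕ) : ∀ g h : ℕ → ℝ, (∀ c, g c ≤ h c) →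
    eventMean n g ≤ eventMean n h := by
  induction n with
  | zero => intro g h hgh; exact hgh 0
  | succ n ih =>
    intro g h hgh
    simp only [eventMean]
    have h1 := ih (fun c => g (c + 1)) (fun c => h (c + 1)) fun c => hgh _
    have h2 := ih g h hgh
    gcongr

lemma abs_eventMean_le (n : ℕ) (g h : ℕ → ℝ) (hgh : ∀ c, |g c| ≤ h c) :
    |eventMean n g| ≤ eventMean n h := by
  rw [abs_le]
  constructor
  · have := eventMean_mono n (fun c => (-1) * h c) g fun c => by linarith [neg_le_of_abs_le (hgh c)]
    rw [eventMean_smul] at this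
    linarith
  · exact eventMean_mono n g h fun c => le_of_abs_le (hgh c)

lemma eventMean_id (n : ℕ) :
    eventMean n (fun c => (c : ℝ)) = 2 * ((harmonic (n + 1) : ℝ) - 1) := by
  induction n with
  | zero => simp [eventMean, harmonic]
  | succ n ih =>
    rw [harmonic_succ]
    simp only [eventMean, Nat.cast_add, Nat.cast_one, eventMean_add, eventMean_const, ih]
    push_cast
    field_simp
    ring

/-- Selecting `m` halves the value with probability `2/m`, which contributes a factor `1 - 1/m`; the
product telescopes. -/
lemma eventMean_half_pow (n : ℕ) :
    eventMean n (fun c => (1 / 2 : ℝ) ^ c) = 1 / (n + 1) := by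
  induction n with
  | zero => simp [eventMean]
  | succ n ih =>
    have : (fun c : ℕ => (1 / 2 : ℝ) ^ (c + 1)) = fun c => (1 / 2 : ℝ) * (1 / 2 : ℝ) ^ c := by
      funext c; ring
    simp only [eventMean, this, eventMean_smul, ih]
    push_cast
    field_simp
    ring

/-- The probability that the last run has length `k`, given `c` fair letters after the first. -/
noncomputable def lastRunProb (k c : ℕ) : ℝ :=
  if c < k then 0 else if c = k then (1 / 2) ^ k else (1 / 2) ^ (k + 1)

/-- The expected number of runs of length `k`, given `c` fair letters after the first. -/
noncomputable def runCountMean (k c : ℕ) : ℝ :=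
  if c < k then 0 else if c = k then (1 / 2) ^ k else (1 / 2) ^ (k + 2) * (c - k + 3)

lemma lastRunProb_zero_succ (c : ℕ) : 2 * lastRunProb 0 (c + 1) = 1 := by
  simp [lastRunProb]

lemma lastRunProb_succ_succ (k c : ℕ) :
    2 * lastRunProb (k + 1) (c + 1) = lastRunProb k c := by
  simp only [lastRunProb, add_lt_add_iff_right, add_left_inj]
  split_ifs <;> ring

/-- Condition on the last letter: it either opens a run of length 0 or lengthens the last run,
creating a run of length `k` if that run had length `k - 1` and destroying one if it had length `k`.
-/
lemma runCountMean_succ (k c : ℕ) :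
    2 * runCountMean k (c + 1) =
      2 * runCountMean k c + 2 * lastRunProb k (c + 1) - lastRunProb k c := by
  rcases lt_trichotomy (c + 1) k with h | h | h
  · simp [runCountMean, lastRunProb, h, show c < k by omega]
  · subst h
    simp [runCountMean, lastRunProb]
  · rcases (Nat.lt_succ_iff.1 h).eq_or_lt with h' | h'
    · subst h'
      simp only [runCountMean, lastRunProb]
      simp
      ring
    · simp only [runCountMean, lastRunProb, if_neg (show ¬ c < k by omega),
        if_neg (show ¬ c + 1 < k by omega), if_neg (show ¬ c = k by omega),
        if_neg (show ¬ c + 1 = k by omega)]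
      push_cast
      ring

lemma lowestMean_zero (n : ℕ) : lowestMean n (fun _ => 0) = 0 := by
  induction n with
  | zero => rfl
  | succ n ih => simp [lowestMean, ih]

lemma totalMean_one (n : ℕ) : totalMean n (fun _ => 1) = harmonic (n + 1) := by
  induction n with
  | zero => simp [totalMean, harmonic]
  | succ n ih =>
    rw [harmonic_succ]
    simp only [totalMean, ih]
    push_cast
    field_simp
    ring

/-- The indicator function of `k`. -/
def single (k c : ℕ) : ℝ := if c = k then 1 else 0

lemma single_zero_shift : (fun c => single 0 (c + 1)) = fun _ => 0 := by
  funext c; simp [single]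

lemma single_succ_shift (k : ℕ) : (fun c => single (k + 1) (c + 1)) = single k := by
  funext c; simp [single]

/-- The lowest point is the start of the last run, and its exposed points are the letters of that
run. -/
lemma lowestMean_single (n : ℕ) :
    ∀ k, lowestMean n (single k) = eventMean n (lastRunProb k) := by
  induction n with
  | zero =>
    intro k
    rcases k with _ | k <;> simp [lowestMean, eventMean, single, lastRunProb]
  | succ n ih =>
    intro k
    simp only [lowestMean, eventMean]
    rw [← eventMean_smul]
    rcases k with _ | k
    · simp only [single_zero_shift, lowestMean_zero, lastRunProb_zero_succ, eventMean_const, ih]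
      simp [single]
    · simp only [single_succ_shift, lastRunProb_succ_succ, ih]
      simp [single]

lemma two_mul_eventMean_lastRunProb_shift (n k : ℕ) :
    2 * eventMean n (fun c => lastRunProb k (c + 1)) =
      single k 0 + lowestMean n (fun c => single k (c + 1)) := by
  rw [← eventMean_smul]
  rcases k with _ | k
  · simp only [single_zero_shift, lowestMean_zero, lastRunProb_zero_succ, eventMean_const]
    simp [single]
  · simp only [single_succ_shift, lastRunProb_succ_succ, lowestMean_single]
    simp [single]

lemma totalMean_single (n k : ℕ) :
    totalMean n (single k) = eventMean n (runCountMean k) := by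
  induction n with
  | zero =>
    rcases k with _ | k <;> simp [totalMean, eventMean, single, runCountMean]
  | succ n ih =>
    have h : (fun c => 2 * runCountMean k (c + 1)) = fun c => 2 * runCountMean k c +
        (2 * lastRunProb k (c + 1) + (-1) * lastRunProb k c) := by
      funext c
      rw [runCountMean_succ]
      ring
    simp only [totalMean, eventMean]
    rw [← eventMean_smul, h, eventMean_add, eventMean_add, eventMean_smul, eventMean_smul,
      eventMean_smul, two_mul_eventMean_lastRunProb_shift, ← lowestMean_single, ih]
    field_simp
    ring

/-- For `c > k` the first and last runs have length `k` with probability `2^(-(k+1))` each, and each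
of the `c - k - 1` possible inner runs occurs with probability `2^(-(k+2))`; this is the affine
expression exactly. Only `c ≤ k` needs an estimate. -/
lemma runCountMean_sub_le (k c : ℕ) :
    |runCountMean k c - (1 / 2 : ℝ) ^ (k + 2) * (c - k + 3)| ≤ 1 / 4 * (1 / 2 : ℝ) ^ c := by
  rcases lt_trichotomy c k with h | h | h
  · obtain ⟨d, rfl⟩ := Nat.exists_eq_add_of_lt h
    simp only [runCountMean, if_pos h]
    -- With `k = c + d + 1` the affine expression is `2^(-c)/4` times `(2 - d) / 2^(d+1)`.
    have hd : |(2 : ℝ) - d| ≤ 2 ^ (d + 1) := by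
      have h1 : (d : ℝ) + 1 ≤ 2 ^ d := by exact_mod_cast Nat.lt_two_pow_self
      rw [pow_succ, abs_le]
      constructor <;> linarith [(Nat.cast_nonneg d : (0 : ℝ) ≤ d)]
    have he : (0 : ℝ) - (1 / 2) ^ (c + d + 1 + 2) * (c - (c + d + 1 : ℕ) + 3) =
        -(1 / 4 * (1 / 2) ^ c * ((1 / 2) ^ (d + 1) * (2 - d))) := by
      push_cast
      ring
    rw [he, abs_neg, abs_mul, abs_of_pos (by positivity : (0 : ℝ) < 1 / 4 * (1 / 2) ^ c), abs_mul,
      abs_of_pos (by positivity : (0 : ℝ) < (1 / 2) ^ (d + 1))]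
    refine mul_le_of_le_one_right (by positivity) ?_
    calc (1 / 2 : ℝ) ^ (d + 1) * |2 - (d : ℝ)| ≤ (1 / 2) ^ (d + 1) * 2 ^ (d + 1) := by gcongr
      _ = 1 := by rw [← mul_pow]; norm_num
  · subst h
    simp only [runCountMean, lt_irrefl, if_true, if_false]
    rw [show (1 / 2 : ℝ) ^ c - (1 / 2) ^ (c + 2) * (c - c + 3) = 1 / 4 * (1 / 2) ^ c by ring,
      abs_of_pos (by positivity)]
  · simp only [runCountMean, if_neg h.not_gt, if_neg h.ne', sub_self, abs_zero]
    positivity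

lemma abs_totalMean_single_sub_le (n k : ℕ) :
    |totalMean n (single k) - ((1 / 2 : ℝ) ^ (k + 1) * harmonic (n + 1) -
      ((k : ℝ) - 1) * (1 / 2) ^ (k + 2))| ≤ 1 / (4 * (n + 1)) := by
  have h : (1 / 2 : ℝ) ^ (k + 1) * harmonic (n + 1) - ((k : ℝ) - 1) * (1 / 2) ^ (k + 2) =
      eventMean n fun c => (1 / 2 : ℝ) ^ (k + 2) * ((c : ℝ) + (3 - k)) := by
    rw [eventMean_smul, eventMean_add, eventMean_const, eventMean_id]
    ring
  have h' : totalMean n (single k) - ((1 / 2 : ℝ) ^ (k + 1) * harmonic (n + 1) -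
      ((k : ℝ) - 1) * (1 / 2) ^ (k + 2)) =
      eventMean n fun c => runCountMean k c +
        (-1) * ((1 / 2 : ℝ) ^ (k + 2) * ((c : ℝ) + (3 - k))) := by
    rw [h, totalMean_single, eventMean_add, eventMean_smul n (-1)]
    ring
  rw [h']
  refine (abs_eventMean_le n _ (fun c => 1 / 4 * (1 / 2 : ℝ) ^ c) fun c => ?_).trans_eq ?_
  · convert runCountMean_sub_le k c using 2
    ring
  · rw [eventMean_smul, eventMean_half_pow]
    field_simp

/-! ### Symmetries of the law of uniform points -/

/-- Domination among the points of a finite family in the plane. -/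
def pointDom {ι : Type*} (x : ι → ℝ × ℝ) (i j : ι) : Prop := Prec (x i) (x j)

/-- The uniform distribution on `(0, 1)`. -/
noncomputable def unitUniform : Measure ℝ := volume.restrict (Set.Ioo 0 1)

instance : IsProbabilityMeasure unitUniform := ⟨by simp [unitUniform]⟩

/-- The law of `n` independent uniform points of the unit square. -/
noncomputable def pointsLaw (n : ℕ) : Measure (Fin n → ℝ × ℝ) :=
  Measure.pi fun _ => unitUniform.prod unitUniform

instance (n : ℕ) : IsProbabilityMeasure (pointsLaw n) := by unfold pointsLaw; infer_instance

lemma measurable_pointDom {ι : Type*} : Measurable (pointDom (ι := ι)) := by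
  refine measurable_pi_lambda _ fun i => measurable_pi_lambda _ fun j => ?_
  refine measurable_to_prop ?_
  have : (fun x : ι → ℝ × ℝ => pointDom x i j) ⁻¹' {True} =
      {x | (x i).1 < (x j).1} ∩ {x | (x i).2 < (x j).2} := by
    ext x
    simp [pointDom, Prec]
  rw [this]
  exact (measurableSet_lt (by fun_prop) (by fun_prop)).inter
    (measurableSet_lt (by fun_prop) (by fun_prop))

lemma measurable_comp_pointDom {n : ℕ} (f : (Fin n → Fin n → Prop) → ℝ) :
    Measurable fun x : Fin n → ℝ × ℝ => f (pointDom x) :=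
  (measurable_of_finite f).comp measurable_pointDom

lemma exists_forall_abs_le_of_finite {α : Type*} [Finite α] (f : α → ℝ) : ∃ C, ∀ a, |f a| ≤ C := by
  obtain ⟨C, hC⟩ := (Set.finite_range fun a => |f a|).bddAbove
  exact ⟨C, fun a => hC ⟨a, rfl⟩⟩

lemma integrable_comp_pointDom {n : ℕ} (f : (Fin n → Fin n → Prop) → ℝ) :
    Integrable (fun x => f (pointDom x)) (pointsLaw n) := by
  obtain ⟨C, hC⟩ := exists_forall_abs_le_of_finite f
  exact Integrable.of_bound (measurable_comp_pointDom f).aestronglyMeasurable C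
    (ae_of_all _ fun x => hC _)

lemma measurePreserving_comp_perm {n : ℕ} {α : Type*} [MeasurableSpace α] (μ : Measure α)
    [SigmaFinite μ] (π : Equiv.Perm (Fin n)) :
    MeasurePreserving (fun y : Fin n → α => y ∘ π) (Measure.pi fun _ => μ)
      (Measure.pi fun _ => μ) := by
  convert! measurePreserving_piCongrLeft (α := fun _ : Fin n => α) (fun _ => μ) π.symm using 1
  funext y i
  obtain ⟨j, rfl⟩ := π.symm.surjective i
  rw [MeasurableEquiv.coe_piCongrLeft, Equiv.piCongrLeft_apply_apply]
  simp

/-- Ties lie in the proper subspaces `y i = y j`, which are Lebesgue null. -/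
lemma ae_injective_pi (n : ℕ) :
    ∀ᵐ y ∂(Measure.pi fun _ : Fin n => unitUniform), Function.Injective y := by
  have h : ∀ i j : Fin n, i ≠ j → ∀ᵐ y : Fin n → ℝ, y i ≠ y j := by
    intro i j hij
    let S : Submodule ℝ (Fin n → ℝ) :=
      LinearMap.ker ((LinearMap.proj i : (Fin n → ℝ) →ₗ[ℝ] ℝ) - LinearMap.proj j)
    have hS : S ≠ ⊤ := by
      intro htop
      have : (Pi.single i 1 : Fin n → ℝ) ∈ S := htop ▸ Submodule.mem_top
      simp [S, hij.symm] at this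
    have h0 := Measure.addHaar_submodule (volume : Measure (Fin n → ℝ)) S hS
    rw [ae_iff]
    convert h0 using 2
    ext y
    simp [S, sub_eq_zero]
  have hpi : (Measure.pi fun _ : Fin n => unitUniform) =
      (volume : Measure (Fin n → ℝ)).restrict (Set.univ.pi fun _ => Set.Ioo 0 1) := by
    rw [volume_pi, Measure.restrict_pi_pi]
    rfl
  rw [hpi]
  refine ae_restrict_of_ae ?_
  have h' : ∀ᵐ y : Fin n → ℝ, ∀ i j : Fin n, i ≠ j → y i ≠ y j := by
    simp only [ae_all_iff, Filter.eventually_imp_distrib_left]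
    exact h
  filter_upwards [h'] with y hy i j hyij
  by_contra hij
  exact hy i j hij hyij

lemma ae_injective_fst (n : ℕ) :
    ∀ᵐ x ∂(pointsLaw n), Function.Injective fun i => (x i).1 :=
  (measurePreserving_pi (fun _ : Fin n => unitUniform.prod unitUniform) (fun _ => unitUniform)
    fun _ => measurePreserving_fst).quasiMeasurePreserving.ae (ae_injective_pi n)

lemma ae_injective_snd (n : ℕ) :
    ∀ᵐ x ∂(pointsLaw n), Function.Injective fun i => (x i).2 :=
  (measurePreserving_pi (fun _ : Fin n => unitUniform.prod unitUniform) (fun _ => unitUniform)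
    fun _ => measurePreserving_snd).quasiMeasurePreserving.ae (ae_injective_pi n)

/-- Permuting the second coordinates of the points. -/
def permuteSnd {n : ℕ} (π : Equiv.Perm (Fin n)) (x : Fin n → ℝ × ℝ) (i : Fin n) : ℝ × ℝ :=
  ((x i).1, (x (π i)).2)

lemma measurePreserving_permuteSnd {n : ℕ} (π : Equiv.Perm (Fin n)) :
    MeasurePreserving (permuteSnd π) (pointsLaw n) (pointsLaw n) := by
  have he := measurePreserving_arrowProdEquivProdArrow ℝ ℝ (Fin n) (fun _ => unitUniform)
    fun _ => unitUniform
  exact (he.symm _).comp (((MeasurePreserving.id _).prod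
    (measurePreserving_comp_perm unitUniform π)).comp he)

lemma sum_totalWeight_permuteSnd {n : ℕ} (F : ℕ → ℝ) {x : Fin (n + 1) → ℝ × ℝ}
    (h₁ : Function.Injective fun i => (x i).1) (h₂ : Function.Injective fun i => (x i).2) :
    ∑ π : Equiv.Perm (Fin (n + 1)), totalWeight F (pointDom (permuteSnd π x)) =
      (n + 1).factorial * totalMean n F := by
  -- `Tuple.sort` sorts increasingly while `seqDom` wants decreasing first coordinates, hence the
  -- sign.
  set u : Fin (n + 1) → ℝ := fun i => -(x i).1 with hu
  have hinj : Function.Injective u := fun i j h => h₁ (neg_injective h)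
  set σ := Tuple.sort u
  have hmono : StrictMono (u ∘ σ) :=
    (Tuple.monotone_sort u).strictMono_of_injective (hinj.comp σ.injective)
  have hlt : ∀ i j, (x (σ i)).1 < (x (σ j)).1 ↔ j < i := by
    intro i j
    rw [← hmono.lt_iff_lt]
    simp [hu]
  rw [← sum_perm_totalWeight n _ h₂ F]
  -- Relabelling the points by `σ` turns `π` into `π * σ`, which again runs over all permutations.
  conv_rhs => rw [← Equiv.sum_comp (Equiv.mulRight σ)]
  refine Finset.sum_congr rfl fun π _ => ?_
  rw [← totalWeight_equiv F _ σ]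
  congr 1
  funext i j
  simp [pointDom, Prec, permuteSnd, seqDom, hlt]

lemma integral_totalWeight (n : ℕ) (F : ℕ → ℝ) :
    ∫ x, totalWeight F (pointDom x) ∂(pointsLaw (n + 1)) = totalMean n F := by
  have hπ : ∀ π : Equiv.Perm (Fin (n + 1)),
      ∫ x, totalWeight F (pointDom (permuteSnd π x)) ∂(pointsLaw (n + 1)) =
        ∫ x, totalWeight F (pointDom x) ∂(pointsLaw (n + 1)) := fun π => by
    have h := measurePreserving_permuteSnd π
    rw [← integral_map h.measurable.aemeasurable
      (f := fun x => totalWeight F (pointDom x))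
      (measurable_comp_pointDom _).aestronglyMeasurable, h.map_eq]
  have hint : ∀ π : Equiv.Perm (Fin (n + 1)),
      Integrable (fun x => totalWeight F (pointDom (permuteSnd π x))) (pointsLaw (n + 1)) :=
    fun π => (measurePreserving_permuteSnd π).integrable_comp_of_integrable
      (integrable_comp_pointDom (totalWeight F))
  have hsum : ∫ x, ∑ π : Equiv.Perm (Fin (n + 1)), totalWeight F (pointDom (permuteSnd π x))
      ∂(pointsLaw (n + 1)) = (n + 1).factorial * totalMean n F := by
    rw [integral_congr_ae (g := fun _ => ((n + 1).factorial : ℝ) * totalMean n F)]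
    · simp
    · filter_upwards [ae_injective_fst (n + 1), ae_injective_snd (n + 1)] with x h₁ h₂
      exact sum_totalWeight_permuteSnd F h₁ h₂
  rw [integral_finsetSum _ fun π _ => hint π, Finset.sum_congr rfl fun π _ => hπ π] at hsum
  simp only [Finset.sum_const, Finset.card_univ, Fintype.card_perm, Fintype.card_fin,
    nsmul_eq_mul] at hsum
  exact mul_left_cancel₀ (by positivity) hsum

/-- Swapping two points preserves the law, so all `n + 1` summands of the total weight have the same
mean. -/
lemma integral_recordWeight (n : ℕ) (F : ℕ → ℝ) (a : Fin (n + 1)) :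
    ∫ x, recordWeight F (pointDom x) a ∂(pointsLaw (n + 1)) = totalMean n F / (n + 1) := by
  have hb : ∀ b, ∫ x, recordWeight F (pointDom x) b ∂(pointsLaw (n + 1)) =
      ∫ x, recordWeight F (pointDom x) a ∂(pointsLaw (n + 1)) := by
    intro b
    have h := measurePreserving_comp_perm (unitUniform.prod unitUniform) (Equiv.swap a b)
    change MeasurePreserving _ (pointsLaw (n + 1)) (pointsLaw (n + 1)) at h
    conv_rhs => rw [← h.map_eq]
    rw [integral_map h.measurable.aemeasurable
      (measurable_comp_pointDom fun d => recordWeight F d a).aestronglyMeasurable]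
    refine integral_congr_ae (ae_of_all _ fun x => ?_)
    have := recordWeight_equiv F (pointDom x) (Equiv.swap a b) a
    rw [Equiv.swap_apply_left] at this
    exact this.symm
  have hsum := integral_totalWeight n F
  simp only [totalWeight] at hsum
  rw [integral_finsetSum _ fun b _ => integrable_comp_pointDom fun d => recordWeight F d b,
    Finset.sum_congr rfl fun b _ => hb b] at hsum
  simp only [Finset.sum_const, Finset.card_univ, Fintype.card_fin, nsmul_eq_mul, Nat.cast_add,
    Nat.cast_one] at hsum
  rw [← hsum]
  field_simp

/-! ### Records of a sequence as weights of its newest point -/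

/-- The first `n` observations as a family of points. -/
def observations (x : ℕ → ℝ × ℝ) (n : ℕ) (i : Fin n) : ℝ × ℝ := x (i + 1)

lemma mem_exposed {ι : Type*} [Fintype ι] {d : ι → ι → Prop} {j m : ι} :
    m ∈ exposed d j ↔ d j m ∧ ∀ i, i ≠ j → ¬ d i m := by
  simp [exposed]

lemma prec_irrefl (p : ℝ × ℝ) : ¬ Prec p p := fun h => lt_irrefl _ h.1

lemma setsRecord_iff (x : ℕ → ℝ × ℝ) (n : ℕ) :
    SetsRecord x (n + 1) ↔ ∀ i, ¬ pointDom (observations x (n + 1)) i (Fin.last n) := by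
  simp only [SetsRecord, pointDom, observations, Fin.val_last]
  constructor
  · intro h i
    by_cases hi : i.val = n
    · rw [hi]; exact prec_irrefl _
    · exact h _ (by omega) (by omega)
  · intro h i hi hin
    have := h ⟨i - 1, by omega⟩
    simpa [Nat.sub_add_cancel hi] using this

/-- A current record is killed precisely when the newest point becomes its only dominator. Index `m`
stands for time `m + 1`. -/
lemma card_killedTimes (x : ℕ → ℝ × ℝ) (n : ℕ) :
    (killedTimes x (n + 1)).card =
      (exposed (pointDom (observations x (n + 1))) (Fin.last n)).card := by
  classical
  symm
  refine Finset.card_bij (fun m _ => m.val + 1) ?_ ?_ ?_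
  · intro m hm
    simp only [mem_exposed, pointDom, observations, Fin.val_last] at hm
    obtain ⟨h1, h2⟩ := hm
    have hmn : m.val ≠ n := by
      intro h
      rw [h] at h1
      exact prec_irrefl _ h1
    have := m.2
    simp only [killedTimes, IsCurrentRecord, Finset.mem_filter, Finset.mem_Ico,
      Nat.add_sub_cancel]
    refine ⟨⟨by omega, by omega⟩, ⟨by omega, by omega, fun i hi hin => ?_⟩, fun h => ?_⟩
    · have := h2 ⟨i - 1, by omega⟩ (by simp [Fin.ext_iff]; omega)
      simpa [Nat.sub_add_cancel hi] using this
    · exact h.2.2 (n + 1) (by omega) le_rfl h1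
  · intro m _ m' _ h
    exact Fin.ext (by omega)
  · intro j hj
    simp only [killedTimes, IsCurrentRecord, Finset.mem_filter, Finset.mem_Ico,
      Nat.add_sub_cancel] at hj
    obtain ⟨⟨h1, h2⟩, ⟨-, h3, h4⟩, h5⟩ := hj
    refine ⟨⟨j - 1, by omega⟩, ?_, Nat.sub_add_cancel h1⟩
    simp only [mem_exposed, pointDom, observations, Fin.val_last, Nat.sub_add_cancel h1]
    constructor
    · by_contra hn
      refine h5 ⟨h1, by omega, fun i hi hin => ?_⟩
      rcases hin.eq_or_lt with rfl | hlt
      · exact hn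
      · exact h4 i hi (by omega)
    · intro i hi
      have := i.2
      have hne : i.val ≠ n := fun h => hi (Fin.ext h)
      exact h4 _ (by omega) (by omega)

open Classical in
lemma ite_setsRecord_eq_recordWeight (x : ℕ → ℝ × ℝ) (n : ℕ) :
    (if SetsRecord x (n + 1) then (1 : ℝ) else 0) =
      recordWeight (fun _ => 1) (pointDom (observations x (n + 1))) (Fin.last n) := by
  simp only [recordWeight, setsRecord_iff]

open Classical in
lemma ite_killsExactly_eq_recordWeight (x : ℕ → ℝ × ℝ) (n k : ℕ) :
    (if KillsExactly x (n + 1) k then (1 : ℝ) else 0) =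
      recordWeight (single k) (pointDom (observations x (n + 1))) (Fin.last n) := by
  simp only [recordWeight, single, KillsExactly, setsRecord_iff, card_killedTimes, ite_and]
  congr!

lemma sum_Icc_one_eq_sum_range (f : ℕ → ℝ) (n : ℕ) :
    ∑ i ∈ Finset.Icc 1 n, f i = ∑ i ∈ Finset.range n, f (i + 1) := by
  rw [Finset.range_eq_Ico, Finset.sum_Ico_add' f 0 n 1]
  rfl

lemma numRecords_eq_sum (x : ℕ → ℝ × ℝ) (n : ℕ) :
    (numRecords x n : ℝ) = ∑ i ∈ Finset.range n,
      recordWeight (fun _ => 1) (pointDom (observations x (i + 1))) (Fin.last i) := by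
  classical
  rw [numRecords, Finset.card_filter, Nat.cast_sum, sum_Icc_one_eq_sum_range]
  refine Finset.sum_congr rfl fun i _ => ?_
  rw [← ite_setsRecord_eq_recordWeight]
  push_cast
  congr!

lemma numRecordsKilling_eq_sum (x : ℕ → ℝ × ℝ) (n k : ℕ) :
    (numRecordsKilling x n k : ℝ) = ∑ i ∈ Finset.range n,
      recordWeight (single k) (pointDom (observations x (i + 1))) (Fin.last i) := by
  classical
  rw [numRecordsKilling, Finset.card_filter, Nat.cast_sum, sum_Icc_one_eq_sum_range]
  refine Finset.sum_congr rfl fun i _ => ?_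
  rw [← ite_killsExactly_eq_recordWeight]
  push_cast
  congr!

/-! ### Expected record counts -/

section Law

variable {Ω : Type*} [MeasurableSpace Ω] {P : Measure Ω}
  {X : ℕ → Ω → ℝ × ℝ}

lemma volume_unitSquare : volume (Set.Ioo (0 : ℝ) 1 ×ˢ Set.Ioo (0 : ℝ) 1) = 1 := by
  simp [Measure.volume_eq_prod]

lemma map_eq_of_isUniform {Y : Ω → ℝ × ℝ}
    (hY : pdf.IsUniform Y (Set.Ioo (0 : ℝ) 1 ×ˢ Set.Ioo (0 : ℝ) 1) P volume) :
    P.map Y = unitUniform.prod unitUniform := by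
  rw [hY, ProbabilityTheory.cond, volume_unitSquare, inv_one, one_smul, unitUniform,
    Measure.prod_restrict, Measure.volume_eq_prod]

lemma aemeasurable_of_isUniform {Y : Ω → ℝ × ℝ}
    (hY : pdf.IsUniform Y (Set.Ioo (0 : ℝ) 1 ×ˢ Set.Ioo (0 : ℝ) 1) P volume) :
    AEMeasurable Y P :=
  hY.aemeasurable (by simp [volume_unitSquare]) (by simp [volume_unitSquare])

variable (hindep : iIndepFun (fun i : ℕ => X (i + 1)) P)
  (hunif : ∀ i : ℕ, 1 ≤ i →
    pdf.IsUniform (X i) (Set.Ioo (0 : ℝ) 1 ×ˢ Set.Ioo (0 : ℝ) 1) P volume)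

include hunif in
lemma aemeasurable_observations (n : ℕ) :
    AEMeasurable (fun ω => observations (fun i => X i ω) n) P :=
  aemeasurable_pi_lambda _ fun i => aemeasurable_of_isUniform (hunif _ (by omega))

variable [IsProbabilityMeasure P]

include hindep hunif in
lemma map_observations (n : ℕ) :
    P.map (fun ω => observations (fun i => X i ω) n) = pointsLaw n := by
  have h := (iIndepFun_iff_map_fun_eq_pi_map fun i : Fin n =>
    aemeasurable_of_isUniform (hunif (i + 1) (by omega))).1
      (hindep.precomp (g := fun i : Fin n => (i : ℕ)) Fin.val_injective)
  refine h.trans ?_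
  rw [pointsLaw]
  congr 1
  funext i
  exact map_eq_of_isUniform (hunif _ (by omega))

include hunif in
lemma integrable_recordWeight (F : ℕ → ℝ) (n : ℕ) (a : Fin n) :
    Integrable (fun ω => recordWeight F (pointDom (observations (fun i => X i ω) n)) a) P := by
  obtain ⟨C, hC⟩ := exists_forall_abs_le_of_finite fun d : Fin n → Fin n → Prop =>
    recordWeight F d a
  exact Integrable.of_bound
    ((measurable_comp_pointDom fun d => recordWeight F d a).comp_aemeasurable
      (aemeasurable_observations hunif n)).aestronglyMeasurable C (ae_of_all _ fun ω => hC _)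

include hindep hunif in
lemma integral_recordWeight_observations (F : ℕ → ℝ) (n : ℕ) :
    ∫ ω, recordWeight F (pointDom (observations (fun i => X i ω) (n + 1))) (Fin.last n) ∂P =
      totalMean n F / (n + 1) := by
  rw [← integral_recordWeight n F (Fin.last n), ← map_observations hindep hunif (n + 1),
    integral_map (aemeasurable_observations hunif _)
      (measurable_comp_pointDom fun d => recordWeight F d (Fin.last n)).aestronglyMeasurable]

include hunif in
lemma integrable_numRecords (n : ℕ) :
    Integrable (fun ω => (numRecords (fun i => X i ω) n : ℝ)) P := by
  simp only [numRecords_eq_sum]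
  exact integrable_finsetSum _ fun i _ => integrable_recordWeight hunif _ _ _

include hunif in
lemma integrable_numRecordsKilling (n k : ℕ) :
    Integrable (fun ω => (numRecordsKilling (fun i => X i ω) n k : ℝ)) P := by
  simp only [numRecordsKilling_eq_sum]
  exact integrable_finsetSum _ fun i _ => integrable_recordWeight hunif _ _ _

include hindep hunif in
lemma rho_eq_romanHarmonic2 (n : ℕ) : rho P X n = romanHarmonic2 n := by
  simp only [rho, numRecords_eq_sum]
  rw [integral_finsetSum _ fun i _ => integrable_recordWeight hunif _ _ _, romanHarmonic2,
    sum_Icc_one_eq_sum_range]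
  refine Finset.sum_congr rfl fun i _ => ?_
  rw [integral_recordWeight_observations hindep hunif, totalMean_one]
  push_cast
  rfl

include hindep hunif in
lemma rhoKilling_eq_sum (n k : ℕ) :
    rhoKilling P X n k = ∑ i ∈ Finset.range n, totalMean i (single k) / (i + 1) := by
  simp only [rhoKilling, numRecordsKilling_eq_sum]
  rw [integral_finsetSum _ fun i _ => integrable_recordWeight hunif _ _ _]
  exact Finset.sum_congr rfl fun i _ => integral_recordWeight_observations hindep hunif _ _

include hindep hunif in
lemma abs_rhoKilling_sub_rhoHat_le (n k : ℕ) :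
    |rhoKilling P X n k - rhoHat n k| ≤ harmonic2 n / 2 := by
  have hharm : (harmonic n : ℝ) = ∑ i ∈ Finset.range n, 1 / ((i : ℝ) + 1) := by
    simp [harmonic]
  rw [rhoKilling_eq_sum hindep hunif, rhoHat, romanHarmonic2, harmonic2,
    sum_Icc_one_eq_sum_range, sum_Icc_one_eq_sum_range, hharm, Finset.mul_sum, Finset.mul_sum,
    ← Finset.sum_sub_distrib, ← Finset.sum_sub_distrib, Finset.sum_div]
  refine (Finset.abs_sum_le_sum_abs _ _).trans (Finset.sum_le_sum fun i _ => ?_)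
  have h := abs_totalMean_single_sub_le i k
  have hi : (0 : ℝ) < i + 1 := by positivity
  have he : totalMean i (single k) / ((i : ℝ) + 1) -
      ((1 / 2 : ℝ) ^ (k + 1) * ((harmonic (i + 1) : ℝ) / ((i + 1 : ℕ) : ℝ)) -
        ((k : ℝ) - 1) * (1 / 2) ^ (k + 2) * (1 / ((i : ℝ) + 1))) =
      (totalMean i (single k) - ((1 / 2 : ℝ) ^ (k + 1) * harmonic (i + 1) -
        ((k : ℝ) - 1) * (1 / 2) ^ (k + 2))) / (i + 1) := by
    push_cast
    field_simp
  rw [he, abs_div, abs_of_pos hi]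
  calc _ ≤ 1 / (4 * ((i : ℝ) + 1)) / (i + 1) := by gcongr
    -- There is a factor 2 to spare here.
    _ ≤ 1 / ((i + 1 : ℕ) : ℝ) ^ 2 / 2 := by
      push_cast
      rw [div_div, div_div]
      exact one_div_le_one_div_of_le (by positivity) (by nlinarith [sq_nonneg ((i : ℝ) + 1)])

end Law

/-! ### Numerical bounds and the uniform limit -/

lemma harmonic2_lt_two (n : ℕ) : harmonic2 n < 2 := by
  have h : harmonic2 n ≤ Real.pi ^ 2 / 6 :=
    sum_le_hasSum _ (fun i _ => by positivity) hasSum_zeta_two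
  have hpi : Real.pi ^ 2 < 12 := by nlinarith [Real.pi_lt_d2, Real.pi_pos]
  linarith

/-- From `n` to `n + 1` the right side grows by `2 H_(n+1) / (n+1)`, which is the growth of the left
side plus `1/(n+1)^2`. -/
lemma sq_harmonic_le (n : ℕ) : (harmonic n : ℝ) ^ 2 ≤ 2 * romanHarmonic2 n := by
  rw [romanHarmonic2, sum_Icc_one_eq_sum_range]
  induction n with
  | zero => simp
  | succ n ih =>
    rw [Finset.sum_range_succ, mul_add]
    have h : (harmonic (n + 1) : ℝ) = harmonic n + 1 / (n + 1) := by
      rw [harmonic_succ]; push_cast; simp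
    push_cast at ih ⊢
    rw [h]
    have h1 : (0 : ℝ) ≤ 1 / ((n : ℝ) + 1) := by positivity
    rw [div_eq_mul_one_div (_ + _) ((n : ℝ) + 1)]
    nlinarith [sq_nonneg (1 / ((n : ℝ) + 1))]

lemma abs_sub_one_mul_half_pow_le (k : ℕ) : |((k : ℝ) - 1) * (1 / 2) ^ (k + 2)| ≤ 1 := by
  have h1 : (k : ℝ) + 1 ≤ 2 ^ k := by exact_mod_cast Nat.lt_two_pow_self
  have hk : (0 : ℝ) ≤ k := k.cast_nonneg
  have h2 : |(k : ℝ) - 1| ≤ 2 ^ k := by rw [abs_le]; constructor <;> linarith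
  rw [abs_mul, abs_of_pos (by positivity : (0 : ℝ) < (1 / 2) ^ (k + 2))]
  calc |(k : ℝ) - 1| * (1 / 2) ^ (k + 2) ≤ 2 ^ k * (1 / 2) ^ (k + 2) := by gcongr
    _ = 1 / 4 := by rw [pow_add, ← mul_assoc, ← mul_pow]; norm_num
    _ ≤ 1 := by norm_num

lemma tendsto_harmonic_atTop : Tendsto (fun n => (harmonic n : ℝ)) atTop atTop :=
  tendsto_atTop_mono log_add_one_le_harmonic
    (Real.tendsto_log_atTop.comp (tendsto_natCast_atTop_atTop.comp (tendsto_add_atTop_nat 1)))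

lemma abs_div_romanHarmonic2_sub_le {n : ℕ} (hn : 1 ≤ n) (k : ℕ) {r : ℝ}
    (hr : |r - rhoHat n k| ≤ 1) :
    |r / romanHarmonic2 n - (1 / 2 : ℝ) ^ (k + 1)| ≤ 4 / harmonic n := by
  have hH : (1 : ℝ) ≤ harmonic n := by
    rw [harmonic_eq_sum_Icc]
    push_cast
    have := Finset.single_le_sum (f := fun i : ℕ => (i : ℝ)⁻¹) (fun i _ => by positivity)
      (Finset.mem_Icc.2 ⟨le_rfl, hn⟩)
    simpa using this
  have hc := sq_harmonic_le n
  have hcpos : 0 < romanHarmonic2 n := by nlinarith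
  have h2 : |((k : ℝ) - 1) * (1 / 2) ^ (k + 2) * (harmonic n : ℝ)| ≤ harmonic n := by
    rw [abs_mul, abs_of_pos (by linarith : (0 : ℝ) < harmonic n)]
    exact mul_le_of_le_one_left (by linarith) (abs_sub_one_mul_half_pow_le k)
  -- The error is at most `1 + H_n`, and `1 ≤ H_n`.
  have h3 : |r - (1 / 2 : ℝ) ^ (k + 1) * romanHarmonic2 n| ≤ 2 * harmonic n := by
    rw [rhoHat] at hr
    rw [abs_le] at hr h2 ⊢
    constructor <;> linarith [hr.1, hr.2, h2.1, h2.2]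
  rw [div_sub' hcpos.ne', abs_div, abs_of_pos hcpos, div_le_div_iff₀ hcpos (by linarith),
    mul_comm (romanHarmonic2 n)]
  nlinarith

end ParetoRecords

theorem lemmaL {Ω : Type*} [MeasurableSpace Ω] (P : Measure Ω) [IsProbabilityMeasure P]
    (X : ℕ → Ω → ℝ × ℝ)
    (hindep : iIndepFun (fun i : ℕ => X (i + 1)) P)
    (hunif : ∀ i : ℕ, 1 ≤ i →
      pdf.IsUniform (X i) (Set.Ioo (0 : ℝ) 1 ×ˢ Set.Ioo (0 : ℝ) 1) P volume) :
    (∀ n : ℕ, 1 ≤ n →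
      Integrable (fun ω => (ParetoRecords.numRecords (fun i => X i ω) n : ℝ)) P ∧
      ParetoRecords.rho P X n = ParetoRecords.romanHarmonic2 n) ∧
    (∀ n : ℕ, 1 ≤ n → ∀ k : ℕ,
      Integrable (fun ω => (ParetoRecords.numRecordsKilling (fun i => X i ω) n k : ℝ)) P ∧
      |ParetoRecords.rhoKilling P X n k - ParetoRecords.rhoHat n k|
        ≤ ParetoRecords.harmonic2 n / 2 ∧
      ParetoRecords.harmonic2 n / 2 < 1) ∧
    TendstoUniformly
      (fun (n : ℕ) (k : ℕ) => ParetoRecords.rhoKilling P X n k / ParetoRecords.rho P X n)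
      (fun k : ℕ => (1 / 2 : ℝ) ^ (k + 1)) atTop := by
  have hlt : ∀ n, ParetoRecords.harmonic2 n / 2 < 1 := fun n => by
    linarith [ParetoRecords.harmonic2_lt_two n]
  refine ⟨fun n _ => ⟨ParetoRecords.integrable_numRecords hunif n,
    ParetoRecords.rho_eq_romanHarmonic2 hindep hunif n⟩, fun n _ k =>
    ⟨ParetoRecords.integrable_numRecordsKilling hunif n k,
      ParetoRecords.abs_rhoKilling_sub_rhoHat_le hindep hunif n k, hlt n⟩, ?_⟩
  rw [Metric.tendstoUniformly_iff]
  intro ε hε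
  have hlim : Tendsto (fun n => 4 / (harmonic n : ℝ)) atTop (nhds 0) :=
    ParetoRecords.tendsto_harmonic_atTop.const_div_atTop 4
  filter_upwards [hlim.eventually_lt_const hε, eventually_ge_atTop 1] with n hn hn1 k
  rw [dist_comm, Real.dist_eq, ParetoRecords.rho_eq_romanHarmonic2 hindep hunif]
  exact (ParetoRecords.abs_div_romanHarmonic2_sub_le hn1 k
    ((ParetoRecords.abs_rhoKilling_sub_rhoHat_le hindep hunif n k).trans (hlt n).le)).trans_lt hn
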